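/- Let $d,s$ be positive integers, let $p$ be an odd prime and let $r\in\{1,-1\}$. Assume that $p^s+r\ge d\ge 3$, $\gcd(p,d)=1$ and $p^s\equiv -r\pmod d$. Put $$M=\frac{dp^s-p^s-r}{d},$$ which is a nonnegative integer. Write $(x)_0=1$ and $(x)_k=x(x+1)\cdots(x+k-1)$ for $k\ge 1$. Then, for $m=M$ and also for $m=p^s-1$, $$\sum_{k=0}^{m}(2dk+r)\frac{(r/d)_k^6}{k!^6}\equiv\frac{(2r/d)_{M}}{(1)_{M}}\sum_{k=0}^{M}\frac{(r/d)_k^3\,(1-r/d)_k}{k!^3\,(2r/d)_k}\left\{(d-1)p^s-(d-1)^3p^{3s}\sum_{j=1}^{k}\left(\frac{1}{(dj)^2}+\frac{1}{(dj-d+r)^2}\right)\right\}\pmod{p^{s+5}}.$$ Here, for rational numbers $x$ and $y$, the congruence $x\equiv y\pmod{p^N}$ means that $x-y=p^N\,a/b$ for some integers $a,b$ with $p\nmid b$. -/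

import Mathlib

open Finset
open scoped Nat

/-- The shifted factorial (Pochhammer symbol) `(x)_k = x (x + 1) ⋯ (x + k - 1)`, with `(x)_0 = 1`. -/
noncomputable def shiftedFactorial (x : ℚ) (k : ℕ) : ℚ :=
  (ascPochhammer ℚ k).eval x

/-- Congruence of rational numbers modulo `p ^ N`: `x - y` is `p ^ N` times a fraction
whose denominator is prime to `p`, i.e. `x - y ∈ p ^ N ℤ_(p)`. -/
def RatCongr (p N : ℕ) (x y : ℚ) : Prop :=
  ∃ a b : ℤ, ¬ (p : ℤ) ∣ b ∧ x - y = (p : ℚ) ^ N * ((a : ℚ) / (b : ℚ))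

/-- The natural number `(d n - n - r) / d`. For `n ≡ -r` modulo `d` and `r ≤ d n - n` the division
is exact and the integer is nonnegative, see `truncIndex_spec`. -/
def truncIndex (d n : ℕ) (r : ℤ) : ℕ :=
  (((d : ℤ) * (n : ℤ) - (n : ℤ) - r) / (d : ℤ)).toNat

theorem truncIndex_spec (d n : ℕ) (r : ℤ) (hd : 0 < d) (hr : r ≤ (d : ℤ) * n - n)
    (h : (n : ℤ) ≡ -r [ZMOD (d : ℤ)]) :
    (d : ℤ) * (truncIndex d n r : ℤ) = (d : ℤ) * n - n - r := by
  have hdvd : (d : ℤ) ∣ (d : ℤ) * n - n - r := by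
    have h1 := h.dvd
    have h2 : (d : ℤ) * n - n - r = (d : ℤ) * n + (-r - n) := by ring
    rw [h2]
    exact dvd_add (dvd_mul_right _ _) h1
  have hnn : (0 : ℤ) ≤ ((d : ℤ) * n - n - r) / (d : ℤ) :=
    Int.ediv_nonneg (by linarith) (by positivity)
  unfold truncIndex
  rw [Int.toNat_of_nonneg hnn, Int.mul_ediv_cancel' hdvd]

/-! Put a = r/d and N = (d-1)p^s/d, so that a + M = N and p^s divides N. Up to the factor r, the
left side is F(0,0), where F(u,v) = `vwpSum a u v m` is a truncated very-well-poised series, even in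
u and v and symmetric under exchanging them.

Three applications of Bailey's lemma to the unit Bailey pair (`vwpSum_eq`) write F as a double sum
of terms κ·G(v)·C(u) with κ free of u and v. The mixed second difference F(0,0) - F(0,N) - F(N,0) +
F(N,N) is then a sum of products κ·ΔG·ΔC. Here p^(s+1) divides κ (`PadicDvd.vwpCoeff`) and p^2
divides each difference, because N enters through squares of multiples of p. Hence F(0,0) ≡ 2F(N,0)
- F(N,N) modulo p^(s+5).

At u = N the parameter a - N = -M terminates the series, and Whipple's transformation
(`vwpSum_of_terminating`) evaluates both terms as sums up to M. Their prefactor N/a contributes p^s,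
each summand contributes one more p (`PadicDvd.whipple_summand`), and expanding to first order in
N^2 costs only p^4. The linear terms are the reciprocal squares in the statement. Both extra factors
p rest on 3M + 1 ≥ 2p^s, which is where d ≥ 3 enters. -/

/-! ### Shifted factorials. -/

theorem shiftedFactorial_zero (x : ℚ) : shiftedFactorial x 0 = 1 := by
  simp [shiftedFactorial]

theorem shiftedFactorial_succ (x : ℚ) (k : ℕ) :
    shiftedFactorial x (k + 1) = shiftedFactorial x k * (x + k) := by
  simp [shiftedFactorial, ascPochhammer_succ_eval]

theorem shiftedFactorial_eq_prod (x : ℚ) (k : ℕ) :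
    shiftedFactorial x k = ∏ i ∈ range k, (x + i) := by
  induction k with
  | zero => simp [shiftedFactorial_zero]
  | succ k ih => rw [shiftedFactorial_succ, prod_range_succ, ih]

theorem shiftedFactorial_add (x : ℚ) (k l : ℕ) :
    shiftedFactorial x (k + l) = shiftedFactorial x k * shiftedFactorial (x + k) l := by
  induction l with
  | zero => simp [shiftedFactorial_zero]
  | succ l ih =>
    rw [← add_assoc, shiftedFactorial_succ, ih, shiftedFactorial_succ]
    push_cast; ring

theorem shiftedFactorial_succ_left (x : ℚ) (k : ℕ) :
    shiftedFactorial x (k + 1) = x * shiftedFactorial (x + 1) k := by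
  rw [add_comm, shiftedFactorial_add, shiftedFactorial_succ, shiftedFactorial_zero]
  simp

theorem shiftedFactorial_one (k : ℕ) : shiftedFactorial 1 k = k ! := by
  simp [shiftedFactorial]

theorem shiftedFactorial_ne_zero_of_le {x : ℚ} {k l : ℕ} (hkl : k ≤ l)
    (h : shiftedFactorial x l ≠ 0) : shiftedFactorial x k ≠ 0 := by
  obtain ⟨j, rfl⟩ := Nat.exists_eq_add_of_le hkl
  rw [shiftedFactorial_add] at h
  exact left_ne_zero_of_mul h

theorem shiftedFactorial_ne_zero {x : ℚ} {k : ℕ} (h : ∀ i < k, x + i ≠ 0) :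
    shiftedFactorial x k ≠ 0 := by
  rw [shiftedFactorial_eq_prod]
  exact prod_ne_zero_iff.mpr fun i hi => h i (mem_range.mp hi)

theorem shiftedFactorial_reflect (x : ℚ) (k : ℕ) :
    shiftedFactorial x k = (-1) ^ k * shiftedFactorial (1 - x - k) k := by
  rw [shiftedFactorial_eq_prod, shiftedFactorial_eq_prod, ← prod_range_reflect, ← card_range k,
    ← prod_const, card_range, ← prod_mul_distrib]
  refine prod_congr rfl fun i hi => ?_
  have : i + 1 ≤ k := mem_range.mp hi
  rw [Nat.sub_sub, Nat.cast_sub (by omega)]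
  push_cast; ring

theorem shiftedFactorial_neg_mul_factorial (m k : ℕ) (h : k ≤ m) :
    shiftedFactorial (-(m : ℚ)) k * ((m - k)! : ℕ) = (-1) ^ k * (m ! : ℕ) := by
  induction k with
  | zero => simp [shiftedFactorial_zero]
  | succ k ih =>
    have hk : (m - k)! = (m - k) * (m - (k + 1))! := by
      rw [show m - k = (m - (k + 1)) + 1 by omega, Nat.factorial_succ]
    have := ih (by omega)
    rw [hk] at this
    rw [shiftedFactorial_succ, pow_succ, mul_right_comm _ (-1 : ℚ), ← this]
    push_cast [Nat.cast_sub (show k ≤ m by omega)]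
    ring

theorem shiftedFactorial_neg_eq_zero {m k : ℕ} (h : m < k) :
    shiftedFactorial (-(m : ℚ)) k = 0 := by
  rw [shiftedFactorial_eq_prod]
  exact prod_eq_zero (mem_range.mpr h) (by simp)

/-! ### Pfaff–Saalschütz, Bailey's lemma and the unit Bailey pair. -/

/-- The Pfaff–Saalschütz summation formula, in polynomial form. -/
theorem pfaff_saalschuetz (A B c : ℚ) (n : ℕ) :
    ∑ q ∈ antidiagonal n, shiftedFactorial A q.1 * shiftedFactorial B q.1 *
        shiftedFactorial (c - A - B) q.2 * shiftedFactorial (c + q.1) q.2 / (q.1 ! * q.2 !) =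
      shiftedFactorial (c - A) n * shiftedFactorial (c - B) n / n ! := by
  set t : ℕ → ℕ → ℚ := fun l k => shiftedFactorial A l * shiftedFactorial B l *
        shiftedFactorial (c - A - B) k * shiftedFactorial (c + l) k / (l ! * k !) with ht
  change ∑ q ∈ antidiagonal n, t q.1 q.2 = _
  induction n with
  | zero => simp [ht, shiftedFactorial_zero]
  | succ n ih =>
    -- U and V carry terms of the antidiagonal n to the antidiagonal n + 1 by raising k or l. After
    -- reindexing, their multipliers add up to (c - A + n)(c - B + n), the ratio of consecutive
    -- right-hand sides up to n + 1.
    set U : ℕ → ℕ → ℚ := fun l k =>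
      if k = 0 then 0 else (c - A - B + k - 1) * (c + n + l) * t l (k - 1) with hU
    set V : ℕ → ℕ → ℚ := fun l k =>
      if l = 0 then 0 else (A + l - 1) * (B + l - 1) * t (l - 1) k with hV
    have key : ∀ q ∈ antidiagonal (n + 1), (n + 1 : ℚ) * t q.1 q.2 = U q.1 q.2 + V q.1 q.2 := by
      rintro ⟨l, k⟩ hq
      have hlk : l + k = n + 1 := mem_antidiagonal.mp hq
      rcases l with _ | l <;> rcases k with _ | k
      · omega
      · obtain rfl : k = n := by omega
        have := Nat.factorial_ne_zero k
        simp only [hU, hV, ht, shiftedFactorial_zero, shiftedFactorial_succ, Nat.factorial_succ,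
          Nat.add_sub_cancel, Nat.succ_ne_zero, if_false, if_true]
        push_cast
        field_simp
        ring
      · obtain rfl : l = n := by omega
        have := Nat.factorial_ne_zero l
        simp only [hU, hV, ht, shiftedFactorial_zero, shiftedFactorial_succ, Nat.factorial_succ,
          Nat.add_sub_cancel, Nat.succ_ne_zero, if_false, if_true]
        push_cast
        field_simp
        ring
      · obtain rfl : n = l + k + 1 := by omega
        have := Nat.factorial_ne_zero l
        have := Nat.factorial_ne_zero k
        have h1 : shiftedFactorial (c + l) (k + 1) =
            (c + l) * shiftedFactorial (c + (l + 1 : ℕ)) k := by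
          rw [shiftedFactorial_succ_left]; push_cast; ring_nf
        simp only [hU, hV, ht, Nat.add_sub_cancel, Nat.succ_ne_zero, if_false, h1]
        simp only [shiftedFactorial_succ, Nat.factorial_succ]
        push_cast
        field_simp
        ring
    have hn : (n + 1 : ℚ) ≠ 0 := by positivity
    have h2 : (n + 1 : ℚ) * ∑ q ∈ antidiagonal (n + 1), t q.1 q.2 =
        (c - A + n) * (c - B + n) * ∑ q ∈ antidiagonal n, t q.1 q.2 := by
      rw [mul_sum, sum_congr rfl key, sum_add_distrib, Nat.sum_antidiagonal_succ',
        Nat.sum_antidiagonal_succ, mul_sum]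
      simp only [hU, hV, Nat.add_sub_cancel, Nat.succ_ne_zero, if_false, if_true, zero_add]
      rw [← sum_add_distrib]
      refine sum_congr rfl fun q hq => ?_
      have : (q.1 + q.2 : ℚ) = n := by exact_mod_cast mem_antidiagonal.mp hq
      push_cast
      rw [← this]; ring
    rw [ih] at h2
    rw [eq_div_iff (by positivity), Nat.factorial_succ, shiftedFactorial_succ,
      shiftedFactorial_succ]
    have := Nat.factorial_ne_zero n
    field_simp at h2
    push_cast
    linear_combination h2

/-- The second member of the Bailey pair relative to `a` with first member `α`. -/
noncomputable def baileyBeta (a : ℚ) (α : ℕ → ℚ) (L : ℕ) : ℚ :=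
  ∑ k ∈ range (L + 1), α k / ((L - k)! * shiftedFactorial (1 + a) (L + k))

/-- Bailey's lemma. -/
theorem baileyBeta_step (a ρ σ : ℚ) (α : ℕ → ℚ) (m : ℕ)
    (ha : ∀ k, shiftedFactorial (1 + a) k ≠ 0)
    (hρ : shiftedFactorial (1 + a - ρ) m ≠ 0) (hσ : shiftedFactorial (1 + a - σ) m ≠ 0) :
    baileyBeta a (fun k => shiftedFactorial ρ k * shiftedFactorial σ k /
        (shiftedFactorial (1 + a - ρ) k * shiftedFactorial (1 + a - σ) k) * α k) m =
      ∑ L ∈ range (m + 1), shiftedFactorial ρ L * shiftedFactorial σ L *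
        shiftedFactorial (1 + a - ρ - σ) (m - L) /
          ((m - L)! * shiftedFactorial (1 + a - ρ) m * shiftedFactorial (1 + a - σ) m) *
        baileyBeta a α L := by
  simp only [baileyBeta, mul_sum]
  rw [sum_comm' (s' := fun k => Ico k (m + 1)) (t' := range (m + 1))
    (by intro x y; simp only [mem_range, mem_Ico]; omega)]
  refine sum_congr rfl fun k hk => ?_
  obtain ⟨n, rfl⟩ := Nat.exists_eq_add_of_le (Nat.lt_succ_iff.mp (mem_range.mp hk))
  rw [sum_Ico_eq_sum_range, show k + n + 1 - k = n + 1 by omega]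
  -- After exchanging the sums, the inner sum for fixed k is a Saalschütz sum with parameters
  -- shifted by k.
  have key := pfaff_saalschuetz (ρ + k) (σ + k) (1 + a + 2 * k) n
  rw [Nat.sum_antidiagonal_eq_sum_range_succ (fun l j => shiftedFactorial (ρ + k) l *
    shiftedFactorial (σ + k) l * shiftedFactorial (1 + a + 2 * k - (ρ + k) - (σ + k)) j *
    shiftedFactorial (1 + a + 2 * k + l) j / (l ! * j !))] at key
  rw [show 1 + a + 2 * (k : ℚ) - (ρ + k) - (σ + k) = 1 + a - ρ - σ by ring,
    show 1 + a + 2 * (k : ℚ) - (ρ + k) = 1 + a - ρ + k by ring,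
    show 1 + a + 2 * (k : ℚ) - (σ + k) = 1 + a - σ + k by ring] at key
  have hρk := shiftedFactorial_ne_zero_of_le (Nat.le_add_right k n) hρ
  have hσk := shiftedFactorial_ne_zero_of_le (Nat.le_add_right k n) hσ
  have hA := ha (k + n + k)
  have e1 := shiftedFactorial_add (1 + a - ρ) k n
  have e2 := shiftedFactorial_add (1 + a - σ) k n
  have hρn : shiftedFactorial (1 + a - ρ + k) n ≠ 0 := by
    rw [e1] at hρ; exact right_ne_zero_of_mul hρ
  have hσn : shiftedFactorial (1 + a - σ + k) n ≠ 0 := by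
    rw [e2] at hσ; exact right_ne_zero_of_mul hσ
  have step : ∀ l ∈ range (n + 1),
      shiftedFactorial ρ (k + l) * shiftedFactorial σ (k + l) *
        shiftedFactorial (1 + a - ρ - σ) (k + n - (k + l)) /
          ((k + n - (k + l))! * shiftedFactorial (1 + a - ρ) (k + n) *
            shiftedFactorial (1 + a - σ) (k + n)) *
        (α k / ((k + l - k)! * shiftedFactorial (1 + a) (k + l + k))) =
      shiftedFactorial ρ k * shiftedFactorial σ k * α k /
        (shiftedFactorial (1 + a - ρ) (k + n) * shiftedFactorial (1 + a - σ) (k + n) *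
          shiftedFactorial (1 + a) (k + n + k)) *
      (shiftedFactorial (ρ + k) l * shiftedFactorial (σ + k) l *
        shiftedFactorial (1 + a - ρ - σ) (n - l) *
        shiftedFactorial (1 + a + 2 * k + l) (n - l) / (l ! * (n - l)!)) := by
    intro l hl
    have hln : l ≤ n := Nat.lt_succ_iff.mp (mem_range.mp hl)
    rw [show k + n - (k + l) = n - l by omega, show k + l - k = l by omega,
      shiftedFactorial_add ρ, shiftedFactorial_add σ]
    have e3 : shiftedFactorial (1 + a) (k + n + k) = shiftedFactorial (1 + a) (k + l + k) *
        shiftedFactorial (1 + a + 2 * k + l) (n - l) := by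
      rw [show k + n + k = (k + l + k) + (n - l) by omega, shiftedFactorial_add]
      congr 2; push_cast; ring
    have hB := ha (k + l + k)
    have hC : shiftedFactorial (1 + a + 2 * k + l) (n - l) ≠ 0 := by
      rw [e3] at hA; exact right_ne_zero_of_mul hA
    rw [e3]
    have := Nat.factorial_ne_zero l
    have := Nat.factorial_ne_zero (n - l)
    generalize shiftedFactorial (1 + a + 2 * k + l) (n - l) = X at hC ⊢
    field_simp
  rw [sum_congr rfl step, ← mul_sum, key, show k + n - k = n by omega, e1, e2]
  have := Nat.factorial_ne_zero n
  field_simp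

/-- The first member of the unit Bailey pair. -/
noncomputable def unitAlpha (a : ℚ) (k : ℕ) : ℚ :=
  (-1) ^ k * ((a + 2 * k) / a) * (shiftedFactorial a k / k !)

/-- The sum telescopes: its partial sums up to K have a closed form with the factor L - K, which
vanishes at K = L. -/
theorem baileyBeta_unitAlpha (a : ℚ) (h0 : a ≠ 0) (ha : ∀ k, shiftedFactorial (1 + a) k ≠ 0)
    (L : ℕ) : baileyBeta a (unitAlpha a) L = if L = 0 then 1 else 0 := by
  rcases Nat.eq_zero_or_pos L with rfl | hL
  · simp [baileyBeta, unitAlpha, shiftedFactorial_zero, h0]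
  have hL0 : (L : ℚ) ≠ 0 := by positivity
  rw [if_neg hL.ne']
  have partialSum : ∀ K ≤ L, ∑ k ∈ range (K + 1),
      unitAlpha a k / ((L - k)! * shiftedFactorial (1 + a) (L + k)) =
      (-1) ^ K * shiftedFactorial (1 + a) K * (L - K) /
        (K ! * L * (L - K)! * shiftedFactorial (1 + a) (L + K)) := by
    intro K
    induction K with
    | zero =>
      intro _
      have := ha L
      have := Nat.factorial_ne_zero L
      simp [unitAlpha, shiftedFactorial_zero, h0]
      field_simp
    | succ K ih =>
      intro hK
      rw [sum_range_succ, ih (by omega)]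
      have hf : (((L - K)! : ℕ) : ℚ) = (L - K) * ((L - (K + 1))! : ℕ) := by
        rw [show L - K = (L - (K + 1)) + 1 by omega, Nat.factorial_succ]
        push_cast [Nat.cast_sub hK]; ring
      have hLK : (L - K : ℚ) ≠ 0 := by
        have : (K : ℚ) + 1 ≤ L := by exact_mod_cast hK
        linarith
      have h1 := ha (L + (K + 1))
      have e1 := shiftedFactorial_succ (1 + a) (L + K)
      rw [add_assoc L K 1] at e1
      have h2 := ha (L + K)
      have h3 : (1 + a + (L + K : ℕ) : ℚ) ≠ 0 := by
        rw [e1] at h1; exact right_ne_zero_of_mul h1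
      have := Nat.factorial_ne_zero K
      have := Nat.factorial_ne_zero (L - (K + 1))
      rw [hf, e1, unitAlpha, shiftedFactorial_succ_left, add_comm a 1, shiftedFactorial_succ,
        Nat.factorial_succ]
      push_cast at h3 ⊢
      field_simp
      ring
  rw [baileyBeta, partialSum L le_rfl]
  simp

/-! ### Divisibility in the localization at p. -/

/-- The rational number `x` is divisible by `p ^ m` in the localization `ℤ_(p)`. -/
def PadicDvd (p m : ℕ) (x : ℚ) : Prop :=
  padicNorm p x ≤ ((p : ℚ) ^ m)⁻¹

namespace PadicDvd

variable {p m n : ℕ} {x y : ℚ}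

theorem neg (hx : PadicDvd p m x) : PadicDvd p m (-x) := by
  rwa [PadicDvd, padicNorm.neg]

variable [hp : Fact p.Prime]

theorem p_pow_pos (p m : ℕ) [hp : Fact p.Prime] : (0 : ℚ) < (p : ℚ) ^ m :=
  pow_pos (by exact_mod_cast hp.out.pos) m

theorem zero : PadicDvd p m 0 := by
  simp only [PadicDvd, padicNorm.zero]
  exact (inv_pos.mpr (p_pow_pos p m)).le

theorem mono (hx : PadicDvd p m x) (h : n ≤ m) : PadicDvd p n x :=
  hx.trans (inv_anti₀ (p_pow_pos p n)
    (pow_le_pow_right₀ (by exact_mod_cast hp.out.one_le) h))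

theorem add (hx : PadicDvd p m x) (hy : PadicDvd p m y) : PadicDvd p m (x + y) :=
  padicNorm.nonarchimedean.trans (max_le hx hy)

theorem sub (hx : PadicDvd p m x) (hy : PadicDvd p m y) : PadicDvd p m (x - y) := by
  rw [sub_eq_add_neg]; exact hx.add hy.neg

theorem mul (hx : PadicDvd p m x) (hy : PadicDvd p n y) : PadicDvd p (m + n) (x * y) := by
  rw [PadicDvd, padicNorm.mul, pow_add, mul_inv]
  exact mul_le_mul hx hy (padicNorm.nonneg _) (inv_pos.mpr (p_pow_pos p m)).le

theorem mul_left (hx : PadicDvd p 0 x) (hy : PadicDvd p m y) : PadicDvd p m (x * y) := by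
  simpa using hx.mul hy

theorem mul_right (hx : PadicDvd p m x) (hy : PadicDvd p 0 y) : PadicDvd p m (x * y) := by
  simpa using hx.mul hy

theorem int (z : ℤ) : PadicDvd p 0 z := by
  simpa [PadicDvd] using padicNorm.of_int z

theorem nat (z : ℕ) : PadicDvd p 0 z := by
  simpa using int (p := p) (z : ℤ)

theorem one : PadicDvd p 0 1 := by
  simpa using int (p := p) 1

theorem prime_pow (m : ℕ) : PadicDvd p m ((p : ℚ) ^ m) := by
  induction m with
  | zero => simpa using one
  | succ m ih =>
    rw [pow_succ]
    exact ih.mul (by simp [PadicDvd, padicNorm.padicNorm_p_of_prime])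

theorem neg_one_pow (k : ℕ) : PadicDvd p 0 ((-1) ^ k) := by
  exact_mod_cast int (p := p) ((-1) ^ k)

theorem sum {ι : Type*} {s : Finset ι} {f : ι → ℚ} (h : ∀ i ∈ s, PadicDvd p m (f i)) :
    PadicDvd p m (∑ i ∈ s, f i) := by
  induction s using Finset.cons_induction with
  | empty => simpa using zero
  | cons i s hi ih =>
    rw [sum_cons]
    exact (h i (mem_cons_self i s)).add (ih fun j hj => h j (mem_cons_of_mem hj))

theorem prod {ι : Type*} {s : Finset ι} {f : ι → ℚ} (h : ∀ i ∈ s, PadicDvd p 0 (f i)) :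
    PadicDvd p 0 (∏ i ∈ s, f i) := by
  induction s using Finset.cons_induction with
  | empty => simpa using one
  | cons i s hi ih =>
    rw [prod_cons]
    exact (h i (mem_cons_self i s)).mul_left (ih fun j hj => h j (mem_cons_of_mem hj))

theorem inv_of_not_dvd {z : ℤ} (h : ¬ (p : ℤ) ∣ z) : PadicDvd p 0 (z : ℚ)⁻¹ := by
  rw [PadicDvd, ← one_div, padicNorm.div, padicNorm.int_eq_one_iff z |>.mpr h]
  simp

theorem padicNorm_prime_pow (p m : ℕ) [hp : Fact p.Prime] :
    padicNorm p ((p : ℚ) ^ m) = ((p : ℚ) ^ m)⁻¹ := by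
  induction m with
  | zero => simp
  | succ m ih => rw [pow_succ, padicNorm.mul, ih, padicNorm.padicNorm_p_of_prime, mul_inv]

theorem div_prime_pow (h : PadicDvd p (m + n) x) : PadicDvd p n (x / (p : ℚ) ^ m) := by
  have hpm := p_pow_pos p m
  rw [PadicDvd, padicNorm.div, padicNorm_prime_pow, div_inv_eq_mul]
  rw [PadicDvd, pow_add, mul_inv] at h
  calc _ ≤ ((p : ℚ) ^ m)⁻¹ * ((p : ℚ) ^ n)⁻¹ * (p : ℚ) ^ m := by gcongr
    _ = _ := by field_simp

theorem ratCongr (h : PadicDvd p m (x - y)) : RatCongr p m x y := by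
  have hpm := p_pow_pos p m
  set q : ℚ := (x - y) / (p : ℚ) ^ m with hq
  have hq1 : padicNorm p q ≤ 1 := by
    have h' : PadicDvd p (m + 0) (x - y) := h
    have h1 := h'.div_prime_pow
    rwa [PadicDvd, pow_zero, inv_one] at h1
  refine ⟨q.num, q.den, fun hd => ?_, ?_⟩
  · have hu := PadicInt.isUnit_den (p := p) q (by
      rw [Padic.eq_padicNorm]; exact_mod_cast hq1)
    rw [PadicInt.isUnit_iff] at hu
    have : ‖((q.den : ℤ) : ℤ_[p])‖ < 1 := (PadicInt.norm_int_lt_one_iff_dvd _).mpr hd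
    rw [Int.cast_natCast, hu] at this
    exact lt_irrefl _ this
  · rw [Int.cast_natCast, Rat.num_div_den, hq]
    field_simp

/-- The generalized binomial coefficients of a `p`-integral number are `p`-integral. -/
theorem shiftedFactorial_div (hx : PadicDvd p 0 x) (k : ℕ) :
    PadicDvd p 0 (shiftedFactorial x k / k !) := by
  have hx' : ‖(x : ℚ_[p])‖ ≤ 1 := by
    rw [Padic.eq_padicNorm]
    have : padicNorm p x ≤ 1 := by simpa [PadicDvd] using hx
    exact_mod_cast this
  obtain ⟨z, hz⟩ : ∃ z : ℤ_[p], (z : ℚ_[p]) = x := ⟨⟨x, hx'⟩, rfl⟩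
  -- The quotient is identified with `Ring.multichoose z k`, computed inside the p-adic integers.
  have key := Ring.factorial_nsmul_multichoose_eq_ascPochhammer z k
  rw [Polynomial.ascPochhammer_smeval_eq_eval, nsmul_eq_mul] at key
  have e : ((shiftedFactorial x k : ℚ) : ℚ_[p]) =
      (((ascPochhammer ℤ_[p] k).eval z : ℤ_[p]) : ℚ_[p]) := by
    have h1 := ascPochhammer_eval₂ (PadicInt.Coe.ringHom (p := p)) k (PadicInt.Coe.ringHom z)
    have h2 := ascPochhammer_eval₂ (Rat.castHom ℚ_[p]) k (Rat.castHom ℚ_[p] x)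
    rw [Polynomial.eval₂_at_apply] at h1 h2
    have h3 : PadicInt.Coe.ringHom z = Rat.castHom ℚ_[p] x := hz
    rw [h3] at h1
    exact h2.symm.trans h1
  have h4 : ((shiftedFactorial x k / k ! : ℚ) : ℚ_[p]) = (Ring.multichoose z k : ℤ_[p]) := by
    rw [← key] at e
    have : ((k ! : ℕ) : ℚ_[p]) ≠ 0 := by exact_mod_cast Nat.factorial_ne_zero k
    push_cast at e ⊢
    rw [e]
    field_simp
  have h5 := PadicInt.norm_le_one (Ring.multichoose z k)
  rw [PadicInt.norm_def, ← h4, Padic.eq_padicNorm] at h5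
  simp only [PadicDvd, pow_zero, inv_one]
  exact_mod_cast h5

/-- Dividing by a positive integer below `p ^ s` costs at most `p ^ (s - 1)`. -/
theorem div_natCast {s t : ℕ} (hx : PadicDvd p s x) (ht : 0 < t) (hts : t < p ^ s) :
    PadicDvd p 1 (x / t) := by
  obtain ⟨e, u, hu, rfl⟩ := Nat.exists_eq_pow_mul_and_not_dvd ht.ne' p hp.out.ne_one
  have hes : e < s := by
    rw [← Nat.pow_lt_pow_iff_right hp.out.one_lt]
    refine lt_of_le_of_lt (Nat.le_mul_of_pos_right _ ?_) hts
    exact Nat.pos_of_ne_zero fun h => hu (h ▸ dvd_zero p)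
  have h1 : PadicDvd p 1 (x / (p : ℚ) ^ e) := (hx.mono (by omega : e + 1 ≤ s)).div_prime_pow
  have h2 : PadicDvd p 0 ((u : ℤ) : ℚ)⁻¹ := inv_of_not_dvd (by exact_mod_cast hu)
  have := h1.mul_right h2
  push_cast at this ⊢
  rwa [← div_div, div_eq_mul_inv _ (u : ℚ)]

theorem inv_one_sub (hx : PadicDvd p 1 x) : PadicDvd p 0 (1 - x)⁻¹ := by
  have hlt : padicNorm p (-x) < 1 := by
    rw [padicNorm.neg]
    exact lt_of_le_of_lt hx (inv_lt_one_of_one_lt₀ (by simpa using (by exact_mod_cast hp.out.one_lt)))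
  have h1 : padicNorm p (1 + -x) = 1 := by
    rw [padicNorm.add_eq_max_of_ne (by rw [padicNorm.one]; exact hlt.ne'), padicNorm.one,
      max_eq_left hlt.le]
  rw [PadicDvd, ← one_div, padicNorm.div, sub_eq_add_neg, h1]
  simp

theorem one_sub_ne_zero (hx : PadicDvd p 1 x) : 1 - x ≠ 0 := by
  intro h
  obtain rfl : x = 1 := by linarith
  rw [PadicDvd, padicNorm.one, pow_one] at hx
  exact absurd hx (not_le.mpr (inv_lt_one_of_one_lt₀ (by exact_mod_cast hp.out.one_lt)))

/-- Since p divides y/t, the denominator y - t is -t times the unit 1 - y/t. -/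
theorem div_sub_natCast {s t : ℕ} (hx : PadicDvd p s x) (hy : PadicDvd p s y) (ht : 0 < t)
    (hts : t < p ^ s) : PadicDvd p 1 (x / (y - t)) := by
  have h1 := (hx.div_natCast ht hts).mul_right (hy.div_natCast ht hts).inv_one_sub
  have hne := (hy.div_natCast ht hts).one_sub_ne_zero
  have ht0 : (t : ℚ) ≠ 0 := by positivity
  have hne' : y - t ≠ 0 := by
    intro h
    apply hne
    rw [sub_eq_zero.mp h, div_self ht0, sub_self]
  convert h1.neg using 1
  have : (1 - y / t : ℚ) = -((y - t) / t) := by field_simp; ring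
  rw [this]
  field_simp

/-- First-order expansion: every neglected term contains at least two of the small quantities. -/
theorem prod_one_sub {ι : Type*} {S : Finset ι} {ε : ι → ℚ} (h : ∀ i ∈ S, PadicDvd p m (ε i)) :
    PadicDvd p (m + m) (∏ i ∈ S, (1 - ε i) - (1 - ∑ i ∈ S, ε i)) := by
  induction S using Finset.cons_induction with
  | empty => simpa using zero
  | cons i S hi ih =>
    have hS := fun j hj => h j (mem_cons_of_mem hj)
    have hiε := h i (mem_cons_self i S)
    rw [prod_cons, sum_cons]
    have e : (1 - ε i) * ∏ j ∈ S, (1 - ε j) - (1 - (ε i + ∑ j ∈ S, ε j)) =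
        (1 - ε i) * (∏ j ∈ S, (1 - ε j) - (1 - ∑ j ∈ S, ε j)) + ε i * ∑ j ∈ S, ε j := by ring
    rw [e]
    exact ((one.sub (hiε.mono (Nat.zero_le m))).mul_left (ih hS)).add (hiε.mul (sum hS))

theorem prod_one_sub_sub_one {ι : Type*} {S : Finset ι} {ε : ι → ℚ}
    (h : ∀ i ∈ S, PadicDvd p m (ε i)) : PadicDvd p m (∏ i ∈ S, (1 - ε i) - 1) := by
  have := ((prod_one_sub h).mono (Nat.le_add_left m m)).sub (sum h)
  convert this using 1
  ring

theorem prod_one_sub_inv {ι : Type*} {S : Finset ι} {ε : ι → ℚ} (hm : 1 ≤ m)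
    (h : ∀ i ∈ S, PadicDvd p m (ε i)) :
    PadicDvd p (m + m) ((∏ i ∈ S, (1 - ε i))⁻¹ - (1 + ∑ i ∈ S, ε i)) := by
  set P := ∏ i ∈ S, (1 - ε i) with hP
  set σ := ∑ i ∈ S, ε i with hσ
  have h1 : PadicDvd p (m + m) (P - (1 - σ)) := prod_one_sub h
  have h2 : PadicDvd p m (1 - P) := by simpa using (prod_one_sub_sub_one h).neg
  have h2' : PadicDvd p 1 (1 - P) := h2.mono hm
  have hσ' : PadicDvd p m σ := sum h
  have hPi : PadicDvd p 0 P⁻¹ := by simpa using h2'.inv_one_sub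
  have hP0 : P ≠ 0 := by simpa using h2'.one_sub_ne_zero
  have e : P⁻¹ - (1 + σ) = P⁻¹ * (σ * σ - (P - (1 - σ)) * (1 + σ)) := by
    field_simp
    ring
  rw [e]
  exact hPi.mul_left ((hσ'.mul hσ').sub (h1.mul_right (one.add (hσ'.mono (Nat.zero_le m)))))

theorem prod_one_sub_inv_sub_one {ι : Type*} {S : Finset ι} {ε : ι → ℚ} (hm : 1 ≤ m)
    (h : ∀ i ∈ S, PadicDvd p m (ε i)) : PadicDvd p m ((∏ i ∈ S, (1 - ε i))⁻¹ - 1) := by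
  have := ((prod_one_sub_inv hm h).mono (Nat.le_add_left m m)).add (sum h)
  convert this using 1
  ring

/-- If a factor `x + i` of `(x)_k` with `k < p ^ s` is divisible by `p ^ s`, then the generalized
binomial coefficient `(x)_k / k!` is divisible by `p`. -/
theorem shiftedFactorial_div_of_add {s i k : ℕ} (hx : PadicDvd p s (x + i)) (hik : i < k)
    (hks : k < p ^ s) : PadicDvd p 1 (shiftedFactorial x k / k !) := by
  induction i generalizing x k with
  | zero =>
    obtain ⟨k, rfl⟩ := Nat.exists_eq_succ_of_ne_zero hik.ne'
    rw [Nat.cast_zero, add_zero] at hx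
    have h1 := (hx.div_natCast hik hks).mul_right
      (shiftedFactorial_div ((hx.mono (Nat.zero_le s)).add one) k)
    convert h1 using 1
    rw [Nat.succ_eq_add_one, shiftedFactorial_succ_left, Nat.factorial_succ]
    have := Nat.factorial_ne_zero k
    push_cast
    field_simp
  | succ i ih =>
    obtain ⟨k, rfl⟩ := Nat.exists_eq_succ_of_ne_zero (by omega : k ≠ 0)
    have hx' : PadicDvd p s (x + 1 + i) := by
      convert hx using 1; push_cast; ring
    -- Pascal's rule (x)_(k+1)/(k+1)! = (x+1)_(k+1)/(k+1)! - (x+1)_k/k! moves the divisible factor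
    -- from index i + 1 to index i.
    have h1 := (ih hx' (by omega) hks).sub (ih hx' (by omega : i < k) (by omega))
    convert h1 using 1
    have := Nat.factorial_ne_zero k
    rw [Nat.succ_eq_add_one, shiftedFactorial_succ_left, shiftedFactorial_succ,
      Nat.factorial_succ]
    push_cast
    field_simp
    ring

end PadicDvd

/-! ### Very-well-poised series and Whipple's transformation. -/

/-- Only the zeroth term of Bailey's lemma survives for the unit pair. -/
theorem baileyBeta_unitAlpha_step (a b c : ℚ) (L : ℕ) (h0 : a ≠ 0)
    (ha : ∀ k, shiftedFactorial (1 + a) k ≠ 0)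
    (hb : shiftedFactorial (1 + a - b) L ≠ 0) (hc : shiftedFactorial (1 + a - c) L ≠ 0) :
    baileyBeta a (fun k => shiftedFactorial b k * shiftedFactorial c k /
        (shiftedFactorial (1 + a - b) k * shiftedFactorial (1 + a - c) k) * unitAlpha a k) L =
      shiftedFactorial (1 + a - b - c) L /
        (L ! * shiftedFactorial (1 + a - b) L * shiftedFactorial (1 + a - c) L) := by
  rw [baileyBeta_step a b c _ L ha hb hc, sum_eq_single 0]
  · simp [baileyBeta_unitAlpha a h0 ha, shiftedFactorial_zero]
  · intro j _ hj
    rw [baileyBeta_unitAlpha a h0 ha, if_neg hj, mul_zero]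
  · simp

/-- The very-well-poised series with two pairs of free parameters, relative to the unit
Bailey pair. -/
noncomputable def vwpAlpha (a b c d e : ℚ) (k : ℕ) : ℚ :=
  shiftedFactorial d k * shiftedFactorial e k /
      (shiftedFactorial (1 + a - d) k * shiftedFactorial (1 + a - e) k) *
    (shiftedFactorial b k * shiftedFactorial c k /
      (shiftedFactorial (1 + a - b) k * shiftedFactorial (1 + a - c) k) * unitAlpha a k)

/-- Whipple's transformation, as a formula for the second Bailey iterate of the unit pair. -/
theorem baileyBeta_vwpAlpha (a b c d e : ℚ) (L : ℕ) (h0 : a ≠ 0)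
    (ha : ∀ k, shiftedFactorial (1 + a) k ≠ 0)
    (hb : shiftedFactorial (1 + a - b) L ≠ 0) (hc : shiftedFactorial (1 + a - c) L ≠ 0)
    (hd : shiftedFactorial (1 + a - d) L ≠ 0) (he : shiftedFactorial (1 + a - e) L ≠ 0) :
    baileyBeta a (vwpAlpha a b c d e) L =
      ∑ j ∈ range (L + 1), shiftedFactorial d j * shiftedFactorial e j *
        shiftedFactorial (1 + a - d - e) (L - j) /
          ((L - j)! * shiftedFactorial (1 + a - d) L * shiftedFactorial (1 + a - e) L) *
        (shiftedFactorial (1 + a - b - c) j /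
          (j ! * shiftedFactorial (1 + a - b) j * shiftedFactorial (1 + a - c) j)) := by
  unfold vwpAlpha
  rw [baileyBeta_step a d e _ L ha hd he]
  refine sum_congr rfl fun j hj => ?_
  have hjL : j ≤ L := Nat.lt_succ_iff.mp (mem_range.mp hj)
  rw [baileyBeta_unitAlpha_step a b c j h0 ha (shiftedFactorial_ne_zero_of_le hjL hb)
    (shiftedFactorial_ne_zero_of_le hjL hc)]

/-- Bailey's lemma with one parameter chosen so as to produce a truncated series. -/
theorem sum_range_eq_sum_baileyBeta (a f : ℚ) (α : ℕ → ℚ) (m : ℕ)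
    (ha : ∀ k, shiftedFactorial (1 + a) k ≠ 0)
    (hf : shiftedFactorial (1 + a - f) m ≠ 0) :
    ∑ k ∈ range (m + 1), (-1) ^ k * (shiftedFactorial f k / shiftedFactorial (1 + a - f) k) * α k =
      (-1) ^ m * (shiftedFactorial (1 + a) m / shiftedFactorial (1 + a - f) m) *
        ∑ L ∈ range (m + 1), shiftedFactorial f L * shiftedFactorial (1 + a + m) L *
          (shiftedFactorial (-f - m) (m - L) / (m - L)!) * baileyBeta a α L := by
  have hneg : ∀ k ≤ m, shiftedFactorial (-(m : ℚ)) k ≠ 0 := fun k hk => by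
    refine left_ne_zero_of_mul (b := (((m - k)! : ℕ) : ℚ)) ?_
    rw [shiftedFactorial_neg_mul_factorial m k hk]
    have := Nat.factorial_ne_zero m
    positivity
  have hm : (1 + a - (1 + a + m) : ℚ) = -m := by ring
  -- With second parameter 1 + a + m, the quotient (1+a+m)_k/(-m)_k cancels the k-dependence of
  -- (m-k)!·(1+a)_(m+k) up to sign, leaving a plain truncated sum.
  have key := baileyBeta_step a f (1 + a + m) α m ha hf (by rw [hm]; exact hneg m le_rfl)
  rw [hm, show 1 + a - f - (1 + a + m) = -f - m by ring] at key
  have hmm := shiftedFactorial_neg_mul_factorial m m le_rfl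
  rw [Nat.sub_self, Nat.factorial_zero, Nat.cast_one, mul_one] at hmm
  have hA := ha m
  have hm0 := Nat.factorial_ne_zero m
  have lhs : ∑ k ∈ range (m + 1),
      (-1) ^ k * (shiftedFactorial f k / shiftedFactorial (1 + a - f) k) * α k =
      m ! * shiftedFactorial (1 + a) m * baileyBeta a (fun k => shiftedFactorial f k *
        shiftedFactorial (1 + a + m) k / (shiftedFactorial (1 + a - f) k *
          shiftedFactorial (-(m : ℚ)) k) * α k) m := by
    rw [baileyBeta, mul_sum]
    refine sum_congr rfl fun k hk => ?_
    have hkm : k ≤ m := Nat.lt_succ_iff.mp (mem_range.mp hk)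
    have h1 := hneg k hkm
    have h2 := shiftedFactorial_neg_mul_factorial m k hkm
    have h3 := shiftedFactorial_ne_zero_of_le hkm hf
    have h4 := ha (m + k)
    have h5 := Nat.factorial_ne_zero (m - k)
    rw [shiftedFactorial_add] at h4 ⊢
    have h6 := right_ne_zero_of_mul h4
    have h7 : ((-1 : ℚ) ^ k) * (-1) ^ k = 1 := by rw [← mul_pow]; simp
    field_simp
    linear_combination shiftedFactorial f k * α k * (-1) ^ k * h2 +
      shiftedFactorial f k * α k * m ! * h7
  rw [lhs, key, mul_sum, mul_sum]
  refine sum_congr rfl fun L hL => ?_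
  rw [hmm]
  have h5 := Nat.factorial_ne_zero (m - L)
  have h8 : ((-1 : ℚ) ^ m)⁻¹ = (-1) ^ m := by rw [← inv_pow]; norm_num
  rw [mul_comm ((-1 : ℚ) ^ m) (m ! : ℚ), ← mul_assoc _ (m ! : ℚ), div_eq_mul_inv _ (_ * (-1 : ℚ) ^ m),
    mul_inv _ ((-1 : ℚ) ^ m), h8]
  field_simp

/-- The truncated very-well-poised series deformed by two parameters. -/
noncomputable def vwpSum (a u v : ℚ) (m : ℕ) : ℚ :=
  ∑ k ∈ range (m + 1), (a + 2 * k) / a * (shiftedFactorial a k ^ 2 / (k ! : ℚ) ^ 2) *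
    (shiftedFactorial (a + u) k * shiftedFactorial (a - u) k /
      (shiftedFactorial (1 - u) k * shiftedFactorial (1 + u) k)) *
    (shiftedFactorial (a + v) k * shiftedFactorial (a - v) k /
      (shiftedFactorial (1 - v) k * shiftedFactorial (1 + v) k))

theorem vwpSum_comm (a u v : ℚ) (m : ℕ) : vwpSum a u v m = vwpSum a v u m :=
  sum_congr rfl fun k _ => by ring

/-- The coefficient, independent of the deformation, in `vwpSum_eq`. -/
noncomputable def vwpCoeff (a : ℚ) (m L j : ℕ) : ℚ :=
  (-1) ^ m * (shiftedFactorial (1 + a) m / m !) *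
    ((shiftedFactorial a L / L !) * (shiftedFactorial (1 + a + m) L / L !) *
      (shiftedFactorial (-a - m) (m - L) / (m - L)!) *
      ((shiftedFactorial (1 - a) (L - j) / (L - j)!) * (shiftedFactorial (1 - a) j / j !)))

/-- The pairs a ± u, then a ± v, and finally a itself are inserted by successive Bailey steps. This
order leaves u only in the last factor, and v only in the middle one. -/
theorem vwpSum_eq (a u v : ℚ) (m : ℕ) (h0 : a ≠ 0)
    (ha : ∀ k, shiftedFactorial (1 + a) k ≠ 0)
    (hu : ∀ k, shiftedFactorial (1 - u) k ≠ 0) (hu' : ∀ k, shiftedFactorial (1 + u) k ≠ 0)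
    (hv : ∀ k, shiftedFactorial (1 - v) k ≠ 0) (hv' : ∀ k, shiftedFactorial (1 + v) k ≠ 0) :
    vwpSum a u v m = ∑ L ∈ range (m + 1), ∑ j ∈ range (L + 1), vwpCoeff a m L j *
      (shiftedFactorial (a + v) j / j ! * (shiftedFactorial (a - v) j / j !) *
        ((L ! : ℚ) ^ 2 / (shiftedFactorial (1 - v) L * shiftedFactorial (1 + v) L))) *
      ((j ! : ℚ) ^ 2 / (shiftedFactorial (1 - u) j * shiftedFactorial (1 + u) j)) := by
  have e1 : 1 + a - a = 1 := by ring
  have key := sum_range_eq_sum_baileyBeta a a (vwpAlpha a (a + u) (a - u) (a + v) (a - v)) m ha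
    (by rw [e1, shiftedFactorial_one]; exact_mod_cast Nat.factorial_ne_zero m)
  have lhs : vwpSum a u v m = ∑ k ∈ range (m + 1), (-1) ^ k *
      (shiftedFactorial a k / shiftedFactorial (1 + a - a) k) *
      vwpAlpha a (a + u) (a - u) (a + v) (a - v) k := by
    refine sum_congr rfl fun k _ => ?_
    have h7 : ((-1 : ℚ) ^ k) * (-1) ^ k = 1 := by rw [← mul_pow]; simp
    rw [vwpAlpha, unitAlpha, e1, shiftedFactorial_one, show 1 + a - (a + u) = 1 - u by ring,
      show 1 + a - (a - u) = 1 + u by ring, show 1 + a - (a + v) = 1 - v by ring,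
      show 1 + a - (a - v) = 1 + v by ring]
    rw [← div_pow]
    generalize shiftedFactorial a k / k ! = A
    generalize (a + 2 * k) / a = B
    generalize shiftedFactorial (a + u) k * shiftedFactorial (a - u) k /
      (shiftedFactorial (1 - u) k * shiftedFactorial (1 + u) k) = C
    generalize shiftedFactorial (a + v) k * shiftedFactorial (a - v) k /
      (shiftedFactorial (1 - v) k * shiftedFactorial (1 + v) k) = D
    linear_combination (-B * A ^ 2 * C * D) * h7
  rw [lhs, key, mul_sum]
  refine sum_congr rfl fun L hL => ?_
  have eu : 1 + a - (a + u) = 1 - u := by ring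
  have eu' : 1 + a - (a - u) = 1 + u := by ring
  have ev : 1 + a - (a + v) = 1 - v := by ring
  have ev' : 1 + a - (a - v) = 1 + v := by ring
  rw [baileyBeta_vwpAlpha _ _ _ _ _ _ h0 ha (by rw [eu]; exact hu L) (by rw [eu']; exact hu' L)
    (by rw [ev]; exact hv L) (by rw [ev']; exact hv' L), mul_sum, mul_sum]
  refine sum_congr rfl fun j hj => ?_
  rw [eu, eu', ev, ev', e1, shiftedFactorial_one, show 1 - u - (a - u) = 1 - a by ring,
    show 1 - v - (a - v) = 1 - a by ring, vwpCoeff]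
  have hL0 : (L ! : ℚ) ≠ 0 := by exact_mod_cast Nat.factorial_ne_zero L
  have hj0 : (j ! : ℚ) ≠ 0 := by exact_mod_cast Nat.factorial_ne_zero j
  have rearrange : ∀ e Y A P X D E Z V V' W U U' : ℚ, ∀ l i : ℚ, l ≠ 0 → i ≠ 0 → ∀ z : ℚ,
      e * Y * (A * P * X * (D * E * Z / (z * V * V') * (W / (i * U * U')))) =
      e * Y * (A / l * (P / l) * X * (Z / z * (W / i))) *
        (D / i * (E / i) * (l ^ 2 / (V * V'))) * (i ^ 2 / (U * U')) := by
    intro e Y A P X D E Z V V' W U U' l i hl hi z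
    have hl' := mul_inv_cancel₀ hl
    have hi' := mul_inv_cancel₀ hi
    simp only [div_eq_mul_inv, mul_inv]
    generalize l⁻¹ = l' at hl' ⊢
    generalize i⁻¹ = i' at hi' ⊢
    linear_combination (-e * Y * A * P * X * D * E * Z * z⁻¹ * V⁻¹ * V'⁻¹ * W * U⁻¹ * U'⁻¹ * i') *
      ((l * l' + 1) * (i * i') ^ 2 * hl' + (i * i' + 1) * hi')
  exact rearrange _ _ _ _ _ _ _ _ _ _ _ _ _ _ _ hL0 hj0 _

/-- The terminating case: if `a - u = -M`, the series is given by Whipple's transformation. -/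
theorem vwpSum_of_terminating (a u v : ℚ) (M m : ℕ) (hM : a + M = u) (hMm : M ≤ m) (h0 : a ≠ 0)
    (ha : ∀ k, shiftedFactorial (1 + a) k ≠ 0) (ha2 : ∀ k, shiftedFactorial (2 * a) k ≠ 0)
    (hu : ∀ k, shiftedFactorial (1 - u) k ≠ 0) (hu' : ∀ k, shiftedFactorial (1 + u) k ≠ 0)
    (hv : ∀ k, shiftedFactorial (1 - v) k ≠ 0) (hv' : ∀ k, shiftedFactorial (1 + v) k ≠ 0) :
    vwpSum a u v m = u / a * (shiftedFactorial (2 * a) M / M !) *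
      ∑ k ∈ range (M + 1), shiftedFactorial (1 - a) k * shiftedFactorial a k *
        (shiftedFactorial (a + u) k * shiftedFactorial (a - u) k) /
          (k ! * shiftedFactorial (2 * a) k *
            (shiftedFactorial (1 - v) k * shiftedFactorial (1 + v) k)) := by
  have e1 : 1 + a - a = 1 := by ring
  have eu : 1 + a - (a + u) = 1 - u := by ring
  have ev : 1 + a - (a + v) = 1 - v := by ring
  have ev' : 1 + a - (a - v) = 1 + v := by ring
  have eM : a - u = -M := by rw [← hM]; ring
  have trunc : vwpSum a u v m = vwpSum a u v M := by
    unfold vwpSum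
    refine (sum_subset (range_subset_range.mpr (by omega)) fun k _ hk => ?_).symm
    rw [eM, shiftedFactorial_neg_eq_zero (k := k) (by simpa using hk)]
    simp
  have hM0 := Nat.factorial_ne_zero M
  -- Two Bailey steps suffice: the missing quotient (a-u)_k/(1+u)_k comes from
  -- 1/((M-k)!·(1+a)_(M+k)), as a - u = -M and 1 + a + M = 1 + u.
  have key := baileyBeta_vwpAlpha a (a + v) (a - v) (a + u) a M h0 ha (by rw [ev]; exact hv M)
    (by rw [ev']; exact hv' M) (by rw [eu]; exact hu M)
    (by rw [e1, shiftedFactorial_one]; exact_mod_cast hM0)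
  have lhs : vwpSum a u v M = M ! * shiftedFactorial (1 + a) M *
      baileyBeta a (vwpAlpha a (a + v) (a - v) (a + u) a) M := by
    rw [vwpSum, baileyBeta, mul_sum]
    refine sum_congr rfl fun k hk => ?_
    have hkM : k ≤ M := Nat.lt_succ_iff.mp (mem_range.mp hk)
    have h7 : ((-1 : ℚ) ^ k) * (-1) ^ k = 1 := by rw [← mul_pow]; simp
    have h2 := shiftedFactorial_neg_mul_factorial M k hkM
    have h4 := ha (M + k)
    rw [vwpAlpha, unitAlpha, e1, shiftedFactorial_one, ev, ev', eu, eM]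
    rw [shiftedFactorial_add, show 1 + a + M = 1 + u by rw [← hM]; ring] at h4 ⊢
    have h5 := Nat.factorial_ne_zero (M - k)
    have h6 := Nat.factorial_ne_zero k
    have h8 := hu k
    have h9 := hu' k
    have h10 := hv k
    have h11 := hv' k
    have h12 := ha M
    field_simp
    linear_combination ((a + 2 * k) * shiftedFactorial a k ^ 2 * shiftedFactorial (a + u) k *
      shiftedFactorial (a + v) k * shiftedFactorial (a - v) k) * h2
  rw [trunc, lhs, key, mul_sum, mul_sum]
  refine sum_congr rfl fun k hk => ?_
  have hkM : k ≤ M := Nat.lt_succ_iff.mp (mem_range.mp hk)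
  -- Both sides equal (a)_(M+1); its last factor is a + M = u and the remaining ones are read
  -- backwards.
  have hP : shiftedFactorial (1 + a) M * a = (-1) ^ M * shiftedFactorial (1 - u) M * u := by
    have h := shiftedFactorial_succ_left a M
    rw [shiftedFactorial_succ, hM, shiftedFactorial_reflect a M,
      show 1 - a - M = 1 - u by rw [← hM]; ring] at h
    rw [add_comm 1 a]
    linear_combination -h
  have hQ : shiftedFactorial (2 * a) M = shiftedFactorial (2 * a) k *
      ((-1) ^ (M - k) * shiftedFactorial (1 - u - a) (M - k)) := by
    obtain ⟨l, rfl⟩ := Nat.exists_eq_add_of_le hkM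
    rw [shiftedFactorial_add, shiftedFactorial_reflect (2 * a + k), Nat.add_sub_cancel_left]
    congr 3
    rw [← hM]; push_cast; ring
  have h2 := shiftedFactorial_neg_mul_factorial M k hkM
  have h7 : ((-1 : ℚ) ^ k) * (-1) ^ (M - k) = (-1) ^ M := by
    rw [← pow_add, Nat.add_sub_cancel' hkM]
  rw [hQ, e1, shiftedFactorial_one, eu, ev, ev', eM, show 1 - v - (a - v) = 1 - a by ring]
  have h5 := Nat.factorial_ne_zero (M - k)
  have h6 := Nat.factorial_ne_zero k
  have h8 := hu M
  have h10 := hv k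
  have h11 := hv' k
  have h13 := ha2 k
  have hP' : shiftedFactorial (1 + a) M = (-1) ^ M * shiftedFactorial (1 - u) M * u / a := by
    rw [eq_div_iff h0, hP]
  rw [hP', ← h7]
  generalize shiftedFactorial (2 * a) k = T at h13 ⊢
  field_simp
  linear_combination (-u * shiftedFactorial (a + u) k * shiftedFactorial a k *
    shiftedFactorial (1 - u - a) (M - k) * shiftedFactorial (1 - a) k) * h2

/-! ### Divisibility estimates for the deformed series. -/

theorem shiftedFactorial_one_sub_mul_one_add (u : ℚ) (k : ℕ) :
    shiftedFactorial (1 - u) k * shiftedFactorial (1 + u) k =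
      (k ! : ℚ) ^ 2 * ∏ i ∈ range k, (1 - (u / (i + 1 : ℕ)) ^ 2) := by
  induction k with
  | zero => simp [shiftedFactorial_zero]
  | succ k ih =>
    rw [shiftedFactorial_succ, shiftedFactorial_succ, prod_range_succ, Nat.factorial_succ]
    have : ((k + 1 : ℕ) : ℚ) ≠ 0 := by positivity
    rw [show (1 - (u / (k + 1 : ℕ)) ^ 2 : ℚ) = (1 - u + k) * (1 + u + k) / ((k + 1 : ℕ) : ℚ) ^ 2 by
      push_cast at this ⊢; field_simp; ring]
    rw [Nat.cast_mul, mul_pow]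
    generalize ∏ i ∈ range k, (1 - (u / (i + 1 : ℕ)) ^ 2) = P at ih ⊢
    field_simp
    linear_combination (1 - u + k) * (1 + u + k) * ih

theorem shiftedFactorial_add_mul_sub (a u : ℚ) (k : ℕ) (h : ∀ i < k, a + i ≠ 0) :
    shiftedFactorial (a + u) k * shiftedFactorial (a - u) k =
      shiftedFactorial a k ^ 2 * ∏ i ∈ range k, (1 - (u / (a + i)) ^ 2) := by
  induction k with
  | zero => simp [shiftedFactorial_zero]
  | succ k ih =>
    have hk := h k (Nat.lt_succ_self k)
    rw [shiftedFactorial_succ, shiftedFactorial_succ, shiftedFactorial_succ, prod_range_succ,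
      show (1 - (u / (a + k)) ^ 2 : ℚ) = (a + u + k) * (a - u + k) / (a + k) ^ 2 by
        field_simp; ring]
    have := ih fun i hi => h i (Nat.lt_succ_of_lt hi)
    generalize ∏ i ∈ range k, (1 - (u / (a + i)) ^ 2) = P at this ⊢
    field_simp
    linear_combination (a + u + k) * (a - u + k) * this

theorem shiftedFactorial_ne_zero_of_not_int {x : ℚ} (h : ∀ z : ℤ, x ≠ z) (k : ℕ) :
    shiftedFactorial x k ≠ 0 :=
  shiftedFactorial_ne_zero fun i _ hi => h (-i) (by push_cast; linarith)

namespace PadicDvd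

variable {p : ℕ} [hp : Fact p.Prime] {s M : ℕ} {a N : ℚ}

theorem div_succ_sq (hN : PadicDvd p s N) {i : ℕ} (hi : i + 1 < p ^ s) :
    PadicDvd p 2 ((N / (i + 1 : ℕ)) ^ 2) := by
  rw [sq]
  exact (hN.div_natCast (Nat.succ_pos i) hi).mul (hN.div_natCast (Nat.succ_pos i) hi)

/-- Here a + i = N - (M - i) with 0 < M - i < p^s, so N/(a+i) is divisible by p. -/
theorem div_add_sq (hN : PadicDvd p s N) (hMN : a + M = N) (hMn : M < p ^ s) {i : ℕ}
    (hi : i < M) : PadicDvd p 2 ((N / (a + i)) ^ 2) := by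
  have h := hN.div_sub_natCast hN (t := M - i) (by omega) (by omega)
  rw [show N - (M - i : ℕ) = a + i by rw [Nat.cast_sub hi.le, ← hMN]; ring] at h
  rw [sq]
  exact h.mul h

/-- The factor of (1-a)_k with index p^s - M - 1 is p^s - N; it occurs as soon as M + k ≥ p^s. -/
theorem shiftedFactorial_one_sub_div (hN : PadicDvd p s N)
    (hMN : a + M = N) (hMn : M < p ^ s) {k : ℕ} (hk : k < p ^ s) (hkM : p ^ s ≤ M + k) :
    PadicDvd p 1 (shiftedFactorial (1 - a) k / k !) := by
  refine shiftedFactorial_div_of_add (s := s) (i := p ^ s - M - 1) ?_ (by omega) hk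
  have h : PadicDvd p s ((p : ℚ) ^ s - N) := (prime_pow s).sub hN
  convert h using 1
  rw [Nat.cast_sub (by omega), Nat.cast_sub hMn.le, ← hMN]
  push_cast; ring

/-- From a·(1+a)_m = (a)_(m+1): for m = M the last factor is N, and for m + 1 = p^s rewriting m! as
(p^s)!/p^s releases p^s. -/
theorem shiftedFactorial_one_add_div (ha : PadicDvd p 0 a) (ha' : PadicDvd p 0 a⁻¹) (h0 : a ≠ 0)
    (hN : PadicDvd p s N) (hMN : a + M = N) {m : ℕ} (hm : m = M ∨ m + 1 = p ^ s) :
    PadicDvd p s (shiftedFactorial (1 + a) m / m !) := by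
  have e : shiftedFactorial (1 + a) m = a⁻¹ * (shiftedFactorial a m * (a + m)) := by
    rw [← shiftedFactorial_succ, shiftedFactorial_succ_left, add_comm 1 a]
    field_simp
  rcases hm with rfl | hm
  · rw [e, hMN]
    have h := (ha'.mul_left hN).mul_right (shiftedFactorial_div ha m)
    convert h using 1
    ring
  · have h := (ha'.mul_left (prime_pow (p := p) s)).mul_right (shiftedFactorial_div ha (m + 1))
    convert h using 1
    rw [e, shiftedFactorial_succ, Nat.factorial_succ, Nat.cast_mul, hm]
    have hps := (p_pow_pos p s).ne'
    have := Nat.factorial_ne_zero m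
    push_cast
    field_simp

/-- The prefactor gives p^s. The extra p comes from a factor -N of (-a-m)_(m-L) if L < M and from a
factor N of (a)_L if L > M. If L = M, then `h3` forces j or M - j to be at least p^s - M, so (1-a)_j
or (1-a)_(M-j) contains p^s - N. -/
theorem vwpCoeff (ha : PadicDvd p 0 a) (ha' : PadicDvd p 0 a⁻¹) (h0 : a ≠ 0)
    (hN : PadicDvd p s N) (hMN : a + M = N) (hMn : M < p ^ s) (h3 : 2 * p ^ s ≤ 3 * M + 1)
    {m L j : ℕ} (hm : m = M ∨ m + 1 = p ^ s) (hL : L ≤ m) (hj : j ≤ L) :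
    PadicDvd p (s + 1) (vwpCoeff a m L j) := by
  have hmn : m < p ^ s := by omega
  have hMm : M ≤ m := by omega
  have h1a : PadicDvd p 0 (1 - a) := one.sub ha
  have hm0 : PadicDvd p 0 (m : ℚ) := nat m
  have pre := (neg_one_pow m).mul_left (shiftedFactorial_one_add_div ha ha' h0 hN hMN hm)
  have f1 := shiftedFactorial_div ha L
  have f2 := shiftedFactorial_div ((one.add ha).add hm0) L
  have f3 := shiftedFactorial_div (ha.neg.sub hm0) (m - L)
  have f4 := shiftedFactorial_div h1a (L - j)
  have f5 := shiftedFactorial_div h1a j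
  refine pre.mul ?_
  rcases lt_trichotomy L M with h | h | h
  · refine (PadicDvd.mul_left (f1.mul_left f2) ?_).mul_right (f4.mul_left f5)
    refine shiftedFactorial_div_of_add (s := s) (i := m - M) ?_ (by omega) (by omega)
    convert hN.neg using 1
    rw [Nat.cast_sub hMm, ← hMN]
    ring
  · refine (((f1.mul_left f2).mul_left f3)).mul_left ?_
    by_cases hjM : p ^ s ≤ M + j
    · exact f4.mul_left (shiftedFactorial_one_sub_div hN hMN hMn (by omega) hjM)
    · exact (shiftedFactorial_one_sub_div hN hMN hMn (by omega) (by omega)).mul_right f5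
  · refine (((PadicDvd.mul_right ?_ f2).mul_right f3)).mul_right (f4.mul_left f5)
    exact shiftedFactorial_div_of_add (s := s) (i := M) (by rwa [hMN]) h (by omega)

theorem factorial_sq_div (hN : PadicDvd p s N) {k : ℕ} (hk : k < p ^ s) :
    PadicDvd p 2 ((k ! : ℚ) ^ 2 / (shiftedFactorial (1 - N) k * shiftedFactorial (1 + N) k) - 1) := by
  have h := prod_one_sub_inv_sub_one (p := p) (m := 2) (S := range k) one_le_two
    (ε := fun i => (N / (i + 1 : ℕ)) ^ 2)
    (fun i hi => hN.div_succ_sq (by have := mem_range.mp hi; omega))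
  convert h using 2
  rw [shiftedFactorial_one_sub_mul_one_add]
  have := Nat.factorial_ne_zero k
  rw [div_mul_eq_div_div, div_self (by positivity), one_div]

theorem shiftedFactorial_deform (ha : PadicDvd p 0 a) (hint : ∀ z : ℤ, a ≠ z)
    (hN : PadicDvd p s N) (hMN : a + M = N) (hMn : M < p ^ s) {j : ℕ} (hj : j < p ^ s) :
    PadicDvd p 2 (shiftedFactorial a j / j ! * (shiftedFactorial a j / j !) -
      shiftedFactorial (a + N) j / j ! * (shiftedFactorial (a - N) j / j !)) := by
  by_cases hjM : j ≤ M
  · have h := prod_one_sub_sub_one (p := p) (m := 2) (S := range j)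
      (ε := fun i => (N / (a + i)) ^ 2)
      (fun i hi => hN.div_add_sq hMN hMn (by have := mem_range.mp hi; omega))
    have h1 := ((shiftedFactorial_div ha j).mul_left (shiftedFactorial_div ha j)).mul_left h.neg
    have e := shiftedFactorial_add_mul_sub a N j
      (fun i _ hi => hint (-i) (by push_cast; linarith))
    convert h1 using 1
    have := Nat.factorial_ne_zero j
    rw [div_mul_div_comm _ _ (shiftedFactorial (a - N) j), e]
    ring
  -- Beyond M the deformed product vanishes, while (a)_j/j! contains the factor a + M = N and is
  -- squared.
  · rw [show a - N = -M by rw [← hMN]; ring, shiftedFactorial_neg_eq_zero (not_le.mp hjM)]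
    have h := shiftedFactorial_div_of_add (s := s) (x := a) (i := M) (by rwa [hMN])
      (not_le.mp hjM) hj
    simpa using h.mul h

/-- The mixed second difference of the deformed series is highly divisible. -/
theorem vwpSum_second_difference (ha : PadicDvd p 0 a) (ha' : PadicDvd p 0 a⁻¹)
    (hint : ∀ z : ℤ, a ≠ z) (hN : PadicDvd p s N) (hMN : a + M = N) (hMn : M < p ^ s)
    (h3 : 2 * p ^ s ≤ 3 * M + 1) {m : ℕ} (hm : m = M ∨ m + 1 = p ^ s) :
    PadicDvd p (s + 5) (vwpSum a 0 0 m - vwpSum a 0 N m - vwpSum a N 0 m + vwpSum a N N m) := by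
  have h0 : a ≠ 0 := by simpa using hint 0
  have ha1 : ∀ k, shiftedFactorial (1 + a) k ≠ 0 := shiftedFactorial_ne_zero_of_not_int
    fun z hz => hint (z - 1) (by push_cast; linarith)
  have hN1 : ∀ k, shiftedFactorial (1 - N) k ≠ 0 := shiftedFactorial_ne_zero_of_not_int
    fun z hz => hint (1 - z - M) (by push_cast; linarith)
  have hN2 : ∀ k, shiftedFactorial (1 + N) k ≠ 0 := shiftedFactorial_ne_zero_of_not_int
    fun z hz => hint (z - 1 - M) (by push_cast; linarith)
  have h00 : ∀ k, (k ! : ℚ) ^ 2 /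
      (shiftedFactorial (1 - 0) k * shiftedFactorial (1 + 0) k) = 1 := fun k => by
    have := Nat.factorial_ne_zero k
    rw [sub_zero, add_zero, shiftedFactorial_one, ← sq, div_self (by positivity)]
  have hz1 : ∀ k, shiftedFactorial (1 - 0) k ≠ 0 := fun k => by
    rw [sub_zero, shiftedFactorial_one]; exact_mod_cast Nat.factorial_ne_zero k
  have hz2 : ∀ k, shiftedFactorial (1 + 0) k ≠ 0 := fun k => by
    rw [add_zero, shiftedFactorial_one]; exact_mod_cast Nat.factorial_ne_zero k
  rw [vwpSum_eq a 0 0 m h0 ha1 hz1 hz2 hz1 hz2, vwpSum_eq a 0 N m h0 ha1 hz1 hz2 hN1 hN2,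
    vwpSum_eq a N 0 m h0 ha1 hN1 hN2 hz1 hz2, vwpSum_eq a N N m h0 ha1 hN1 hN2 hN1 hN2,
    ← sum_sub_distrib, ← sum_sub_distrib, ← sum_add_distrib]
  refine sum fun L hL => ?_
  rw [← sum_sub_distrib, ← sum_sub_distrib, ← sum_add_distrib]
  refine sum fun j hj => ?_
  have hLm : L ≤ m := Nat.lt_succ_iff.mp (mem_range.mp hL)
  have hjL : j ≤ L := Nat.lt_succ_iff.mp (mem_range.mp hj)
  have hmn : m < p ^ s := by omega
  have hκ := vwpCoeff ha ha' h0 hN hMN hMn h3 hm hLm hjL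
  have hC := hN.factorial_sq_div (k := j) (by omega)
  have hV := hN.factorial_sq_div (k := L) (by omega)
  have hG := shiftedFactorial_deform ha hint hN hMN hMn (j := j) (by omega)
  have hN0 : PadicDvd p 0 N := hN.mono (Nat.zero_le s)
  have hA := (shiftedFactorial_div (ha.add hN0) j).mul_left (shiftedFactorial_div (ha.sub hN0) j)
  rw [h00 j, h00 L, add_zero, sub_zero]
  have h := (hκ.mul (hG.sub (hA.mul_left hV))).mul hC.neg
  convert h using 1
  ring

/-- With M = k + l, the denominator (2a)_k cancels against (2a)_M, leaving (2a+k)_l. One copy of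
(a)_k absorbs M!/l!, being congruent to (-M)_k factor by factor. The p comes from p^s - N in (1-a)_k
when k ≥ p^s - M, and otherwise from 2N - p^s in (2a+k)_l, whose index 2M - p^s - k is nonnegative
by `h3`. -/
theorem whipple_summand (ha : PadicDvd p 0 a) (h2int : ∀ z : ℤ, 2 * a ≠ z)
    (hN : PadicDvd p s N) (hMN : a + M = N) (hMn : M < p ^ s)
    (h3 : 2 * p ^ s ≤ 3 * M + 1) {k : ℕ} (hk : k ≤ M) :
    PadicDvd p 1 (shiftedFactorial (2 * a) M / M ! * (shiftedFactorial a k ^ 3 *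
      shiftedFactorial (1 - a) k / ((k ! : ℚ) ^ 3 * shiftedFactorial (2 * a) k))) := by
  obtain ⟨l, rfl⟩ := Nat.exists_eq_add_of_le hk
  have h2a := shiftedFactorial_ne_zero_of_not_int h2int k
  have h2a0 : PadicDvd p 0 (2 * a + k) :=
    ((by exact_mod_cast nat (p := p) 2 : PadicDvd p 0 (2 : ℚ)).mul_left ha).add (nat k)
  have f1 := shiftedFactorial_div ha k
  have f2 : PadicDvd p 0 (shiftedFactorial a k * l ! / (k + l)!) := by
    have h : PadicDvd p 0 (∏ i ∈ range k, (1 - N / (N - (a + i)))) := prod fun i hi => by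
      have hik := mem_range.mp hi
      have h1 := (hN.div_natCast (t := k + l - i) (by omega) (by omega)).mono zero_le_one
      convert one.sub h1 using 3
      rw [Nat.cast_sub (by omega), ← hMN]
      ring
    have h2 := (neg_one_pow (p := p) k).mul_left h
    convert h2 using 1
    have e := shiftedFactorial_neg_mul_factorial (k + l) k (by omega)
    rw [Nat.add_sub_cancel_left] at e
    have hkl := Nat.factorial_ne_zero (k + l)
    have h7 : ((-1 : ℚ) ^ k) * (-1) ^ k = 1 := by rw [← mul_pow]; simp
    have e2 : shiftedFactorial a k = shiftedFactorial (-((k + l : ℕ) : ℚ)) k *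
        ∏ i ∈ range k, (1 - N / (N - (a + i))) := by
      rw [shiftedFactorial_eq_prod, shiftedFactorial_eq_prod, ← prod_mul_distrib]
      refine prod_congr rfl fun i hi => ?_
      have hik := mem_range.mp hi
      have hne : N - (a + i) ≠ 0 := by
        have : (i : ℚ) < (k + l : ℕ) := by exact_mod_cast (by omega : i < k + l)
        rw [← hMN]; intro h; linarith
      have e3 : -((k + l : ℕ) : ℚ) + i = -(N - (a + i)) := by rw [← hMN]; ring
      rw [e3]
      field_simp
      ring
    rw [div_eq_iff (by exact_mod_cast hkl), e2]
    linear_combination (∏ i ∈ range k, (1 - N / (N - (a + i)))) * e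
  have e : shiftedFactorial (2 * a) (k + l) / (k + l)! * (shiftedFactorial a k ^ 3 *
      shiftedFactorial (1 - a) k / ((k ! : ℚ) ^ 3 * shiftedFactorial (2 * a) k)) =
      (shiftedFactorial a k * l ! / (k + l)!) * (shiftedFactorial a k / k !) *
        (shiftedFactorial a k / k !) * ((shiftedFactorial (2 * a + k) l / l !) *
        (shiftedFactorial (1 - a) k / k !)) := by
    rw [shiftedFactorial_add]
    have := Nat.factorial_ne_zero k
    have := Nat.factorial_ne_zero l
    have := Nat.factorial_ne_zero (k + l)
    generalize shiftedFactorial (2 * a) k = T at h2a ⊢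
    generalize shiftedFactorial (2 * a + k) l = T'
    field_simp
  rw [e]
  refine ((f2.mul_left f1).mul_left f1).mul_left ?_
  by_cases hkM : p ^ s ≤ k + l + k
  · exact (shiftedFactorial_div h2a0 l).mul_left
      (shiftedFactorial_one_sub_div hN hMN hMn (by omega) hkM)
  · refine PadicDvd.mul_right ?_ (shiftedFactorial_div (one.sub ha) k)
    refine shiftedFactorial_div_of_add (s := s) (i := 2 * (k + l) - p ^ s - k) ?_
      (by omega) (by omega)
    have h := (hN.add hN).sub (prime_pow (p := p) s)
    convert h using 1
    rw [Nat.cast_sub (by omega), Nat.cast_sub (by omega), ← hMN]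
    push_cast; ring

theorem vwpSum_congr (ha : PadicDvd p 0 a) (ha' : PadicDvd p 0 a⁻¹)
    (hint : ∀ z : ℤ, a ≠ z) (h2int : ∀ z : ℤ, 2 * a ≠ z) (hN : PadicDvd p s N)
    (hMN : a + M = N) (hMn : M < p ^ s)
    (h3 : 2 * p ^ s ≤ 3 * M + 1) {m : ℕ} (hm : m = M ∨ m + 1 = p ^ s) :
    PadicDvd p (s + 5) (vwpSum a 0 0 m - N / a * (shiftedFactorial (2 * a) M / M ! *
      ∑ k ∈ range (M + 1), shiftedFactorial a k ^ 3 * shiftedFactorial (1 - a) k /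
        ((k ! : ℚ) ^ 3 * shiftedFactorial (2 * a) k) *
        (1 - (∑ i ∈ range k, (N / (i + 1 : ℕ)) ^ 2 + ∑ i ∈ range k, (N / (a + i)) ^ 2)))) := by
  have h0 : a ≠ 0 := by simpa using hint 0
  have hMm : M ≤ m := by omega
  have ha1 : ∀ k, shiftedFactorial (1 + a) k ≠ 0 := shiftedFactorial_ne_zero_of_not_int
    fun z hz => hint (z - 1) (by push_cast; linarith)
  have ha2 := shiftedFactorial_ne_zero_of_not_int h2int
  have hN1 : ∀ k, shiftedFactorial (1 - N) k ≠ 0 := shiftedFactorial_ne_zero_of_not_int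
    fun z hz => hint (1 - z - M) (by push_cast; linarith)
  have hN2 : ∀ k, shiftedFactorial (1 + N) k ≠ 0 := shiftedFactorial_ne_zero_of_not_int
    fun z hz => hint (z - 1 - M) (by push_cast; linarith)
  have hz1 : ∀ k, shiftedFactorial (1 - 0) k ≠ 0 := fun k => by
    rw [sub_zero, shiftedFactorial_one]; exact_mod_cast Nat.factorial_ne_zero k
  have hz2 : ∀ k, shiftedFactorial (1 + 0) k ≠ 0 := fun k => by
    rw [add_zero, shiftedFactorial_one]; exact_mod_cast Nat.factorial_ne_zero k
  have main := vwpSum_second_difference ha ha' hint hN hMN hMn h3 hm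
  rw [vwpSum_comm a 0 N] at main
  have w0 := vwpSum_of_terminating a N 0 M m hMN hMm h0 ha1 ha2 hN1 hN2 hz1 hz2
  have w1 := vwpSum_of_terminating a N N M m hMN hMm h0 ha1 ha2 hN1 hN2 hN1 hN2
  have key : PadicDvd p (s + 5) (2 * vwpSum a N 0 m - vwpSum a N N m -
      N / a * (shiftedFactorial (2 * a) M / M ! *
      ∑ k ∈ range (M + 1), shiftedFactorial a k ^ 3 * shiftedFactorial (1 - a) k /
        ((k ! : ℚ) ^ 3 * shiftedFactorial (2 * a) k) *
        (1 - (∑ i ∈ range k, (N / (i + 1 : ℕ)) ^ 2 + ∑ i ∈ range k, (N / (a + i)) ^ 2)))) := by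
    rw [w0, w1, mul_assoc (N / a), mul_assoc (N / a), mul_left_comm 2 (N / a), ← mul_sub,
      ← mul_sub]
    have hNa : PadicDvd p s (N / a) := by rw [div_eq_mul_inv]; exact hN.mul_right ha'
    refine hNa.mul (n := 5) ?_
    rw [← mul_assoc 2, mul_comm 2, mul_assoc, ← mul_sub, ← mul_sub, mul_sum,
      ← sum_sub_distrib, ← sum_sub_distrib, mul_sum]
    refine sum fun k hk => ?_
    have hkM : k ≤ M := Nat.lt_succ_iff.mp (mem_range.mp hk)
    have hE := whipple_summand ha h2int hN hMN hMn h3 hkM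
    have hε : ∀ i ∈ range k, PadicDvd p 2 ((N / (a + i)) ^ 2) := fun i hi =>
      hN.div_add_sq hMN hMn (by have := mem_range.mp hi; omega)
    have hδ : ∀ i ∈ range k, PadicDvd p 2 ((N / (i + 1 : ℕ)) ^ 2) := fun i hi =>
      hN.div_succ_sq (by have := mem_range.mp hi; omega)
    have hP := prod_one_sub hε
    have hP1 := prod_one_sub_sub_one hε
    have hQ := prod_one_sub_inv one_le_two hδ
    have hSε : PadicDvd p 2 (∑ i ∈ range k, (N / (a + i)) ^ 2) := sum hε
    have hSδ : PadicDvd p 2 (∑ i ∈ range k, (N / (i + 1 : ℕ)) ^ 2) := sum hδ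
    have hk0 := Nat.factorial_ne_zero k
    have eN := shiftedFactorial_one_sub_mul_one_add N k
    have e0 : shiftedFactorial (1 - 0) k * shiftedFactorial (1 + 0) k = (k ! : ℚ) ^ 2 := by
      rw [sub_zero, add_zero, shiftedFactorial_one, sq]
    have ea := shiftedFactorial_add_mul_sub a N k
      (fun i _ hi => hint (-i) (by push_cast; linarith))
    rw [eN, e0, ea]
    set P := ∏ i ∈ range k, (1 - (N / (a + i)) ^ 2)
    set R := ∏ i ∈ range k, (1 - (N / (i + 1 : ℕ)) ^ 2)
    set σ := ∑ i ∈ range k, (N / (a + i)) ^ 2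
    set τ := ∑ i ∈ range k, (N / (i + 1 : ℕ)) ^ 2
    have hP0 : PadicDvd p 0 P := by
      have := (hP1.mono (Nat.zero_le 2)).add one
      rwa [sub_add_cancel] at this
    -- This expression equals 2P - P/R - (1 - τ - σ), the error of linearizing one summand of
    -- 2F(N,0) - F(N,N).
    have hbr : PadicDvd p 4 ((1 - τ) * (P - (1 - σ)) + σ * τ - P * (R⁻¹ - (1 + τ))) :=
      (((one.sub (hSδ.mono (Nat.zero_le 2))).mul_left hP).add (hSε.mul hSδ)).sub
        (hP0.mul_left hQ)
    have h := hE.mul hbr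
    convert h using 1
    have hT := ha2 k
    simp only [div_eq_mul_inv, mul_inv]
    ring
  have := main.add key
  convert this using 1
  ring

end PadicDvd

/-! ### Specialization to a = r/d. -/

theorem sum_Icc_one_eq_sum_range (f : ℕ → ℚ) (k : ℕ) :
    ∑ j ∈ Icc 1 k, f j = ∑ i ∈ range k, f (i + 1) := by
  induction k with
  | zero => simp
  | succ k ih => rw [sum_Icc_succ_top (by omega), ih, sum_range_succ]

theorem not_int_of_not_dvd {d : ℕ} {c : ℤ} (hd : 0 < d) (h : ¬ (d : ℤ) ∣ c) (z : ℤ) :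
    (c : ℚ) / d ≠ z := by
  intro hz
  rw [div_eq_iff (by positivity)] at hz
  exact h ⟨z, by rw [mul_comm]; exact_mod_cast hz⟩

theorem corollary5p5 (d s p : ℕ) (r : ℤ) (hp : p.Prime) (hp_odd : Odd p) (hs : 0 < s)
    (hr : r = 1 ∨ r = -1) (hd : 3 ≤ d) (hdn : (d : ℤ) ≤ (p : ℤ) ^ s + r)
    (hpd : Nat.gcd p d = 1) (hmod : (p : ℤ) ^ s ≡ -r [ZMOD (d : ℤ)])
    (m : ℕ) (hm : m = truncIndex d (p ^ s) r ∨ m = p ^ s - 1) :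
    RatCongr p (s + 5)
      (∑ k ∈ range (m + 1),
        (2 * (d : ℚ) * (k : ℚ) + (r : ℚ)) *
          (shiftedFactorial ((r : ℚ) / (d : ℚ)) k ^ 6 / ((k ! : ℕ) : ℚ) ^ 6))
      (shiftedFactorial (2 * (r : ℚ) / (d : ℚ)) (truncIndex d (p ^ s) r) /
          shiftedFactorial 1 (truncIndex d (p ^ s) r) *
        ∑ k ∈ range (truncIndex d (p ^ s) r + 1),
          (shiftedFactorial ((r : ℚ) / (d : ℚ)) k ^ 3 *
              shiftedFactorial (1 - (r : ℚ) / (d : ℚ)) k /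
            (((k ! : ℕ) : ℚ) ^ 3 * shiftedFactorial (2 * (r : ℚ) / (d : ℚ)) k)) *
          (((d : ℚ) - 1) * (p : ℚ) ^ s -
            ((d : ℚ) - 1) ^ 3 * (p : ℚ) ^ (3 * s) *
              ∑ j ∈ Icc 1 k,
                (1 / ((d : ℚ) * (j : ℚ)) ^ 2 +
                  1 / ((d : ℚ) * (j : ℚ) - (d : ℚ) + (r : ℚ)) ^ 2))) := by
  have : Fact p.Prime := ⟨hp⟩
  set M := truncIndex d (p ^ s) r with hMdef
  have hd0 : (d : ℚ) ≠ 0 := by positivity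
  have hd3 : (3 : ℤ) ≤ d := by exact_mod_cast hd
  have hr2 : r * r = 1 := by rcases hr with rfl | rfl <;> norm_num
  have hr0 : (r : ℚ) ≠ 0 := by rcases hr with rfl | rfl <;> norm_num
  have hps : 0 < p ^ s := pow_pos hp.pos s
  have hr1 : r ≤ 1 ∧ -1 ≤ r := by rcases hr with rfl | rfl <;> norm_num
  have hspec : (d : ℤ) * M = d * (p : ℤ) ^ s - (p : ℤ) ^ s - r := by
    have h := truncIndex_spec d (p ^ s) r (by omega)
      (by push_cast; nlinarith [pow_pos (show (0 : ℤ) < p by exact_mod_cast hp.pos) s])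
      (by push_cast; exact hmod)
    push_cast at h
    exact h
  set a : ℚ := (r : ℚ) / d with ha_def
  set N : ℚ := ((d : ℚ) - 1) * (p : ℚ) ^ s / d with hN_def
  have hMN : a + M = N := by
    have h : (d : ℚ) * M = d * (p : ℚ) ^ s - (p : ℚ) ^ s - r := by exact_mod_cast hspec
    rw [ha_def, hN_def]
    field_simp
    linear_combination h
  have hMn : M < p ^ s := by
    have : (M : ℤ) < (p : ℤ) ^ s := by nlinarith
    exact_mod_cast this
  -- d(3M + 1 - 2p^s) = (d-3)p^s + d - 3r, which is nonnegative since d ≥ 3 and r ≤ 1.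
  have h3 : 2 * p ^ s ≤ 3 * M + 1 := by
    have : 2 * (p : ℤ) ^ s ≤ 3 * M + 1 := by
      have h1 : (1 : ℤ) ≤ (p : ℤ) ^ s := by exact_mod_cast hps
      have h2 : 0 ≤ (d : ℤ) * (3 * M + 1 - 2 * (p : ℤ) ^ s) := by nlinarith
      have := nonneg_of_mul_nonneg_right h2 (by omega)
      linarith
    exact_mod_cast this
  have hpd' : ¬ (p : ℤ) ∣ (d : ℤ) := by
    rw [Int.natCast_dvd_natCast, ← hp.coprime_iff_not_dvd]
    exact hpd
  have hdinv : PadicDvd p 0 (d : ℚ)⁻¹ := by exact_mod_cast PadicDvd.inv_of_not_dvd hpd'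
  have ha : PadicDvd p 0 a := by
    rw [ha_def, div_eq_mul_inv]
    exact (PadicDvd.int r).mul_left hdinv
  have ha_inv : a⁻¹ = ((d * r : ℤ) : ℚ) := by
    have : (r : ℚ) * r = 1 := by exact_mod_cast hr2
    rw [ha_def, inv_div]
    push_cast
    field_simp
    linear_combination -this
  have ha' : PadicDvd p 0 a⁻¹ := by
    rw [ha_inv]
    exact PadicDvd.int _
  have hN : PadicDvd p s N := by
    rw [hN_def, div_eq_mul_inv]
    refine PadicDvd.mul_right (PadicDvd.mul_left ?_ (PadicDvd.prime_pow s)) hdinv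
    exact (PadicDvd.nat d).sub PadicDvd.one
  have hint : ∀ z : ℤ, a ≠ z := not_int_of_not_dvd (by omega) fun h => by
    have h' : (d : ℤ) ∣ 1 := hr2 ▸ h.mul_right r
    have := Int.le_of_dvd one_pos h'
    omega
  have h2int : ∀ z : ℤ, 2 * a ≠ z := by
    have h := not_int_of_not_dvd (d := d) (c := 2 * r) (by omega) fun h => by
      have h' : (d : ℤ) ∣ 2 := by
        have := h.mul_right r
        rwa [mul_assoc, hr2, mul_one] at this
      have := Int.le_of_dvd (by norm_num) h'
      omega
    intro z hz
    apply h z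
    rw [← hz, ha_def]
    push_cast; ring
  have hm' : m = M ∨ m + 1 = p ^ s := by
    rcases hm with h | h
    · exact Or.inl h
    · right; omega
  -- Multiplying by r turns (a+2k)/a into 2dk + r and the prefactor N/a into dN = (d-1)p^s.
  have main := (PadicDvd.int (p := p) r).mul_left
    (PadicDvd.vwpSum_congr ha ha' hint h2int hN hMN hMn h3 hm')
  refine PadicDvd.ratCongr ?_
  have h0 : a ≠ 0 := by simpa using hint 0
  convert main using 1
  rw [mul_sub]
  congr 1
  · rw [vwpSum, mul_sum]
    refine sum_congr rfl fun k _ => ?_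
    have hak := shiftedFactorial_ne_zero_of_not_int hint k
    have hk := Nat.factorial_ne_zero k
    have e : (2 * (d : ℚ) * k + r) = r * ((a + 2 * k) / a) := by
      rw [ha_def]
      field_simp
      ring
    rw [e, add_zero, sub_zero, sub_zero, add_zero, shiftedFactorial_one]
    field_simp
  · have e2 : 2 * (r : ℚ) / d = 2 * a := by rw [ha_def]; ring
    have e3 : (r : ℚ) * (N / a) = d * N := by
      rw [ha_def]
      field_simp
    rw [e2, shiftedFactorial_one, ← mul_assoc (r : ℚ), e3, mul_left_comm, mul_sum (a := (d : ℚ) * N)]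
    congr 1
    refine sum_congr rfl fun k _ => ?_
    rw [mul_left_comm]
    congr 1
    rw [sum_Icc_one_eq_sum_range, ← sum_add_distrib, mul_sub, mul_one, mul_sum, mul_sum]
    have e4 : ((d : ℚ) - 1) * (p : ℚ) ^ s = d * N := by
      rw [hN_def]
      field_simp
    have e5 : ((d : ℚ) - 1) ^ 3 * (p : ℚ) ^ (3 * s) = (d * N) ^ 3 := by
      rw [← e4, mul_pow, ← pow_mul, mul_comm s 3]
    rw [e4, e5]
    congr 1
    refine sum_congr rfl fun i _ => ?_
    have hai : a + i ≠ 0 := fun h => hint (-i) (by push_cast; linarith)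
    have e6 : (d : ℚ) * (i + 1 : ℕ) - d + r = d * (a + i) := by
      rw [ha_def]
      push_cast
      field_simp
      ring
    have hi : ((i + 1 : ℕ) : ℚ) ≠ 0 := by positivity
    rw [e6]
    generalize ((i + 1 : ℕ) : ℚ) = t at hi ⊢
    field_simp
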